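/- For $n\ge 1$ let $\Sigma^1_n$, $\Pi^1_n$ denote the (lightface) levels of the analytical hierarchy of subsets of $\omega$, let $\Delta^1_n=\Sigma^1_n\cap\Pi^1_n$, and let $E^1_n=\Pi^1_n$ if $n$ is odd and $E^1_n=\Sigma^1_n$ if $n$ is even. A numbering of a family $\mathcal T\subseteq P(\omega)$ is a surjective map $\nu\colon\omega\to\mathcal T$; it is $E^1_n$-computable if $\{\langle k,x\rangle : x\in\nu(k)\}$ is an $E^1_n$ set, where $\langle\cdot,\cdot\rangle$ is a standard computable pairing function; and $\mathcal T$ is $E^1_n$-computable if it has an $E^1_n$-computable numbering. For numberings, $\nu\le\mu$ means that there is a total computable function $h$ with $\nu(k)=\mu(h(k))$ for all $k\in\omega$. The Rogers semilattice $\mathcal R^1_n(\mathcal T)$ is the upper semilattice of all $E^1_n$-computable numberings of $\mathcal T$ modulo the equivalence $\nu\le\mu\le\nu$, ordered by $\le$; the class of $\nu$ is its degree. In an upper semilattice, $b$ is a minimal cover of $a$ if $a<b$ and there is no $c$ with $a<c<b$. **Proposition.** Let $n\ge 1$, let $\mathcal T$ be an arbitrary $E^1_n$-computable family, and let $\nu$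 be an $E^1_n$-computable numbering of $\mathcal T$. Suppose that there exists a total function $f\colon\omega\to\omega$ such that - the graph of $f$ is $\Delta^1_n$, and - $\nu(k)\ne\nu(f(k))$ for all $k\in\omega$. Then the degree of $\nu$ has a minimal cover in $\mathcal R^1_n(\mathcal T)$. -/

import Mathlib

namespace AnalyticalRogers

/-- Programs for partial computable functionals: the programs of `Nat.Partrec.Code`, together with
one more instruction that queries the oracle. A program plays the role of an index `e`. -/
inductive OracleCode : Type
  | zero : OracleCode
  | succ : OracleCode
  | left : OracleCode
  | right : OracleCode
  | oracle : OracleCode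
  | pair : OracleCode → OracleCode → OracleCode
  | comp : OracleCode → OracleCode → OracleCode
  | prec : OracleCode → OracleCode → OracleCode
  | rfind' : OracleCode → OracleCode

/-- `c.eval g` is the partial function that the program `c` computes with the total oracle
`g : ω → ω`; one and the same program is run on all oracles. The clauses other than `oracle` are
those of `Nat.Partrec.Code.eval`. -/
def OracleCode.eval (g : ℕ → ℕ) : OracleCode → ℕ →. ℕ
  | OracleCode.zero => pure 0
  | OracleCode.succ => Nat.succ
  | OracleCode.left => ↑fun n : ℕ => n.unpair.1
  | OracleCode.right => ↑fun n : ℕ => n.unpair.2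
  | OracleCode.oracle => ↑g
  | OracleCode.pair cf cg => fun n => Nat.pair <$> eval g cf n <*> eval g cg n
  | OracleCode.comp cf cg => fun n => eval g cg n >>= eval g cf
  | OracleCode.prec cf cg =>
    Nat.unpaired fun a n =>
      n.rec (eval g cf a) fun y IH => do
        let i ← IH
        eval g cg (Nat.pair a (Nat.pair y i))
  | OracleCode.rfind' cf =>
    Nat.unpaired fun a m =>
      (Nat.rfind fun n => (fun k => k = 0) <$> eval g cf (Nat.pair a (n + m))).map (· + m)

/-- The join `F 0 ⊕ ⋯ ⊕ F (n - 1)` of a tuple of functions: its value at `n * x + i` with `i < n`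
is `F i x`. -/
def joinTuple : {n : ℕ} → (Fin n → ℕ → ℕ) → ℕ → ℕ
  | 0, _ => fun _ => 0
  | n + 1, F => fun k => F ⟨k % (n + 1), Nat.mod_lt k n.succ_pos⟩ (k / (n + 1))

/-- `R(x, y; f₁, …, fₙ)` is recursive: a single program, run on the oracle `f₁ ⊕ ⋯ ⊕ fₙ`, halts
on all inputs for all oracles, and outputs `1` exactly when `R` holds. -/
def IsRecursivePredicate {n : ℕ} (R : ℕ → ℕ → (Fin n → ℕ → ℕ) → Prop) : Prop :=
  ∃ e : OracleCode, ∀ (F : Fin n → ℕ → ℕ) (x y : ℕ),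
    ∃ v ∈ e.eval (joinTuple F) (Nat.pair x y), (R x y F ↔ v = 1)

mutual

/-- `∃ f₁ ∀ f₂ ∃ f₃ ⋯ Q fₙ Q' y, P y (f₁, …, fₙ)`, where the function quantifiers alternate and the
number quantifier `Q'` is the dual of the last function quantifier `Q`. -/
def existsPrefix : (n : ℕ) → (ℕ → (Fin n → ℕ → ℕ) → Prop) → Prop
  | 0, P => ∃ y, P y Fin.elim0
  | n + 1, P => ∃ f : ℕ → ℕ, forallPrefix n fun y F => P y (Fin.cons f F)

/-- `∀ f₁ ∃ f₂ ∀ f₃ ⋯ Q fₙ Q' y, P y (f₁, …, fₙ)`, where the function quantifiers alternate and the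
number quantifier `Q'` is the dual of the last function quantifier `Q`. -/
def forallPrefix : (n : ℕ) → (ℕ → (Fin n → ℕ → ℕ) → Prop) → Prop
  | 0, P => ∀ y, P y Fin.elim0
  | n + 1, P => ∀ f : ℕ → ℕ, existsPrefix n fun y F => P y (Fin.cons f F)

end

/-- The class of (lightface) `Σ¹ₙ` subsets of `ω`, for `n ≥ 1`. -/
def SigmaOne (n : ℕ) : Set (Set ℕ) :=
  {X | ∃ R : ℕ → ℕ → (Fin n → ℕ → ℕ) → Prop, IsRecursivePredicate R ∧
    ∀ x, x ∈ X ↔ existsPrefix n (R x)}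

/-- The class of (lightface) `Π¹ₙ` subsets of `ω`, for `n ≥ 1`. -/
def PiOne (n : ℕ) : Set (Set ℕ) :=
  {X | ∃ R : ℕ → ℕ → (Fin n → ℕ → ℕ) → Prop, IsRecursivePredicate R ∧
    ∀ x, x ∈ X ↔ forallPrefix n (R x)}

/-- The class of `Δ¹ₙ` subsets of `ω`. -/
def DeltaOne (n : ℕ) : Set (Set ℕ) := SigmaOne n ∩ PiOne n

/-- `E¹ₙ` is `Π¹ₙ` for odd `n`, and `Σ¹ₙ` for even `n`. -/
def EOne (n : ℕ) : Set (Set ℕ) := if Odd n then PiOne n else SigmaOne n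

/-- A numbering `ν` of the family `T` is a map from `ω` onto `T`. It is `Γ`-computable if the set
of all coded pairs `⟨k, x⟩` with `x ∈ ν k` belongs to the class `Γ`. The elements of this type are
all `Γ`-computable numberings of `T`. -/
structure ComputableNumbering (Γ : Set (Set ℕ)) (T : Set (Set ℕ)) where
  toFun : ℕ → Set ℕ
  range_eq : Set.range toFun = T
  mem_class : {z : ℕ | ∃ k x : ℕ, z = Nat.pair k x ∧ x ∈ toFun k} ∈ Γ

instance (Γ T : Set (Set ℕ)) : CoeFun (ComputableNumbering Γ T) fun _ => ℕ → Set ℕ :=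
  ⟨ComputableNumbering.toFun⟩

/-- `ν` is reducible to `μ`: there is a total computable `h` with `ν k = μ (h k)` for all `k`. -/
def Reducible (ν μ : ℕ → Set ℕ) : Prop :=
  ∃ h : ℕ → ℕ, Computable h ∧ ∀ k, ν k = μ (h k)

/-- The numberings of a family are preordered by reducibility. -/
instance (Γ T : Set (Set ℕ)) : Preorder (ComputableNumbering Γ T) where
  le ν μ := Reducible ν μ
  le_refl _ := ⟨id, Computable.id, fun _ => rfl⟩
  le_trans _ _ _ := fun ⟨g, hg, hg'⟩ ⟨h, hh, hh'⟩ =>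
    ⟨fun k => h (g k), hh.comp hg, fun k => (hg' k).trans (hh' (g k))⟩

/-- The Rogers semilattice of the family `T` with respect to the class `Γ`: the `Γ`-computable
numberings of `T` modulo mutual reducibility, partially ordered by reducibility. The join is the
least upper bound in this order. -/
abbrev RogersSemilattice (Γ T : Set (Set ℕ)) : Type :=
  Antisymmetrization (ComputableNumbering Γ T) (· ≤ ·)

/-- The degree of a numbering. -/
def degree {Γ T : Set (Set ℕ)} (ν : ComputableNumbering Γ T) : RogersSemilattice Γ T :=
  toAntisymmetrization (· ≤ ·) ν

/-- In an upper semilattice, `b` is a minimal cover of `a` if `a < b` and there is no `c` with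
`a < c < b`. -/
def IsMinimalCover {A : Type*} [PartialOrder A] (b a : A) : Prop :=
  a < b ∧ ¬ ∃ c, a < c ∧ c < b

end AnalyticalRogers

-- The cover is the degree of `μ = ν ⊕ (ν ∘ f ∘ u)`, for a function `u` with two properties
-- (`exists_minimal_function`). First, `u` agrees somewhere with every total computable function. A
-- computable reduction of `μ` to `ν` would give a computable `h` with `ν (h k) = ν (f (u k))` for
-- all `k`; where `u k = h k` this contradicts `ν (u k) ≠ ν (f (u k))`. So `ν < μ`.
--
-- Second, `u` is minimal: for each computable `h` it factors through some computable `p` such that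
-- `p ∘ h` either is bounded or takes every value above a threshold `s`. Let `ν ≤ κ ≤ μ`, and let
-- `h` describe where the reduction of `κ` lands in the odd half of `μ`. If `p ∘ h` is bounded, a
-- finite table replaces `f ∘ u` and `κ ≤ ν`. Otherwise a search finds, for each `a` with `p a > s`,
-- some `t` with `p (h t) = p a`, hence `u (h t) = u a`; a finite table handles the remaining `a`,
-- and `μ ≤ κ` (`reducible_or_reducible_of_between`).
--
-- To build `u`, start from the identity and coarsen computable surjections `P s` repeatedly. Stage
-- `s` settles the dichotomy for program `s` (`exists_coarsening`), preserves the values up to `s`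
-- and never increases a value, so the `P s` converge pointwise to a function `lim`. On the fibre of
-- `lim` over `j`, `u` takes the value of program `j` at a chosen point of that fibre.
--
-- All choices in the construction are least numbers satisfying conditions with number quantifiers
-- only, so `u` is `Δ¹ₙ` for every `n ≥ 1`. This rests on the closure of `Δ¹ₙ` under number
-- quantifiers, finite Boolean operations and primitive recursion; `E¹ₙ` is closed under preimages
-- by `Δ¹ₙ` functions, so `μ` is `E¹ₙ`-computable.

namespace AnalyticalRogers

-- Oracle programs and substitution for the oracle.

namespace OracleCode

/-- An ordinary program, viewed as a program that never queries the oracle. -/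
def ofCode : Nat.Partrec.Code → OracleCode
  | .zero => zero
  | .succ => succ
  | .left => left
  | .right => right
  | .pair cf cg => pair (ofCode cf) (ofCode cg)
  | .comp cf cg => comp (ofCode cf) (ofCode cg)
  | .prec cf cg => prec (ofCode cf) (ofCode cg)
  | .rfind' cf => rfind' (ofCode cf)

theorem eval_ofCode (g : ℕ → ℕ) (c : Nat.Partrec.Code) : (ofCode c).eval g = c.eval := by
  induction c with
  | zero | succ | left | right => rfl
  | pair cf cg hf hg | comp cf cg hf hg | prec cf cg hf hg =>
    simp only [ofCode, eval, Nat.Partrec.Code.eval, hf, hg]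
    rfl
  | rfind' cf hf =>
    simp only [ofCode, eval, Nat.Partrec.Code.eval, hf]
    rfl

theorem eval_comp (g : ℕ → ℕ) (e₁ e₂ : OracleCode) (n : ℕ) :
    (comp e₁ e₂).eval g n = (e₂.eval g n).bind (e₁.eval g) := rfl

theorem eval_left (g : ℕ → ℕ) (n : ℕ) : left.eval g n = Part.some n.unpair.1 := rfl

theorem eval_right (g : ℕ → ℕ) (n : ℕ) : right.eval g n = Part.some n.unpair.2 := rfl

theorem eval_rfind' (g : ℕ → ℕ) (e : OracleCode) (a m : ℕ) :
    (rfind' e).eval g (Nat.pair a m) = (Nat.rfind fun n =>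
      (fun k => k = 0) <$> eval g e (Nat.pair a (n + m))).map (· + m) := by
  simp only [eval, Nat.unpaired, Nat.unpair_pair]

theorem exists_eval_of_computable {h : ℕ → ℕ} (hh : Computable h) :
    ∃ e : OracleCode, ∀ g n, e.eval g n = Part.some (h n) := by
  obtain ⟨c, hc⟩ := Nat.Partrec.Code.exists_code.1 (Partrec.nat_iff.1 hh.partrec)
  exact ⟨ofCode c, fun g n => by rw [eval_ofCode, hc]; rfl⟩

theorem eval_pair_of_eq {g : ℕ → ℕ} {e₁ e₂ : OracleCode} {n a b : ℕ}
    (h₁ : e₁.eval g n = Part.some a) (h₂ : e₂.eval g n = Part.some b) :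
    (pair e₁ e₂).eval g n = Part.some (Nat.pair a b) := by
  change ((e₁.eval g n).map Nat.pair).bind (fun f => (e₂.eval g n).map f) = _
  rw [h₁, h₂, Part.map_some, Part.bind_some, Part.map_some]

theorem eval_comp_of_eq {g : ℕ → ℕ} {e₁ e₂ : OracleCode} {n a : ℕ}
    (h₂ : e₂.eval g n = Part.some a) :
    (comp e₁ e₂).eval g n = e₁.eval g a := by
  rw [eval_comp, h₂]
  exact Part.bind_some _ _

/-- A program for the map `⟨⟨z, a⟩, b⟩ ↦ ⟨z, ⟨a, b⟩⟩`. -/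
def assoc : OracleCode := pair (comp left left) (pair (comp right left) right)

theorem eval_assoc (g : ℕ → ℕ) (z a b : ℕ) :
    assoc.eval g (Nat.pair (Nat.pair z a) b) = Part.some (Nat.pair z (Nat.pair a b)) := by
  refine eval_pair_of_eq ?_ (eval_pair_of_eq ?_ ?_) <;>
    simp [eval_comp_of_eq (eval_left _ _), eval_left, eval_right]

/-- A program for the map `⟨z, ⟨a, b⟩⟩ ↦ ⟨⟨z, a⟩, b⟩`. -/
def unassoc : OracleCode := pair (pair left (comp left right)) (comp right right)

theorem eval_unassoc (g : ℕ → ℕ) (z a b : ℕ) :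
    unassoc.eval g (Nat.pair z (Nat.pair a b)) = Part.some (Nat.pair (Nat.pair z a) b) := by
  refine eval_pair_of_eq (eval_pair_of_eq ?_ ?_) ?_ <;>
    simp [eval_comp_of_eq (eval_right _ _), eval_left, eval_right]

/-- The program that on input `⟨z, x⟩` runs a given program on `x`, answering each query `k` by
running `c` on `⟨z, k⟩`. -/
def subst (c : OracleCode) : OracleCode → OracleCode
  | zero => zero
  | succ => comp succ right
  | left => comp left right
  | right => comp right right
  | oracle => c
  | pair cf cg => pair (subst c cf) (subst c cg)
  | comp cf cg => comp (subst c cf) (pair left (subst c cg))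
  | prec cf cg => comp (prec (subst c cf) (comp (subst c cg) assoc)) unassoc
  | rfind' cf => comp (rfind' (comp (subst c cf) assoc)) unassoc

/-- The parameter `z` must stay available for later queries, so composition pairs it again with the
intermediate value, and recursion and minimization move it into their own parameter by `unassoc` and
`assoc`. -/
theorem eval_subst {g h : ℕ → ℕ} {c : OracleCode} {z : ℕ}
    (hc : ∀ k, c.eval g (Nat.pair z k) = Part.some (h k)) (e : OracleCode) (x : ℕ) :
    (subst c e).eval g (Nat.pair z x) = e.eval h x := by
  induction e generalizing x with
  | zero => rfl
  | succ | left | right =>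
    simp only [subst, eval_comp_of_eq (eval_right _ _), Nat.unpair_pair]
    rfl
  | oracle => simpa [subst, eval] using hc x
  | pair cf cg hf hg => simp only [subst, eval, hf, hg]
  | comp cf cg hf hg =>
    have hp : (pair left (subst c cg)).eval g (Nat.pair z x) =
        (cg.eval h x).map (Nat.pair z) := by
      change ((left.eval g (Nat.pair z x)).map Nat.pair).bind
        (fun f => ((subst c cg).eval g (Nat.pair z x)).map f) = _
      rw [hg, eval_left]
      simp
    simp only [subst]
    rw [eval_comp, eval_comp, hp]
    exact (Part.bind_map _ _ _).trans (congrArg _ (funext hf))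
  | prec cf cg hf hg =>
    obtain ⟨a, n, rfl⟩ : ∃ a n, x = Nat.pair a n := ⟨_, _, (Nat.pair_unpair x).symm⟩
    simp only [subst]
    rw [eval_comp_of_eq (eval_unassoc _ _ _ _)]
    simp only [eval, Nat.unpaired, Nat.unpair_pair]
    induction n with
    | zero => exact hf a
    | succ n ih =>
      dsimp only at ih ⊢
      rw [ih]
      congr 1
      funext i
      have : (comp (subst c cg) assoc).eval g (Nat.pair (Nat.pair z a) (Nat.pair n i)) =
          cg.eval h (Nat.pair a (Nat.pair n i)) := by
        rw [eval_comp_of_eq (eval_assoc _ _ _ _), hg]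
      exact this
  | rfind' cf hf =>
    obtain ⟨a, n, rfl⟩ : ∃ a n, x = Nat.pair a n := ⟨_, _, (Nat.pair_unpair x).symm⟩
    simp only [subst]
    rw [eval_comp_of_eq (eval_unassoc _ _ _ _)]
    have : ∀ k, (comp (subst c cf) assoc).eval g (Nat.pair (Nat.pair z a) k) =
          cf.eval h (Nat.pair a k) := fun k => by
        rw [eval_comp_of_eq (eval_assoc _ _ _ _), hf]
    simp only [eval_rfind', this]

end OracleCode

-- Closure properties of recursive predicates.

section Recursive

variable {n : ℕ}

/-- Closure of recursive predicates under recursive substitution: the arguments may depend on one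
value of the oracle, and the new oracle may depend on these arguments. -/
theorem IsRecursivePredicate.subst {m : ℕ} {R : ℕ → ℕ → (Fin n → ℕ → ℕ) → Prop}
    (hR : IsRecursivePredicate R) {a b s t : ℕ → ℕ} (ha : Computable a) (hb : Computable b)
    (hs : Computable s) (ht : Computable t) (i : ℕ)
    (Θ : ℕ → (Fin m → ℕ → ℕ) → Fin n → ℕ → ℕ)
    (hΘ : ∀ w F k, joinTuple (Θ w F) k = s (Nat.pair w (joinTuple F (t (Nat.pair w k))))) :
    IsRecursivePredicate fun x y F =>
      R (a (Nat.pair (Nat.pair x y) (joinTuple F i))) (b (Nat.pair (Nat.pair x y) (joinTuple F i)))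
        (Θ (Nat.pair (Nat.pair x y) (joinTuple F i)) F) := by
  obtain ⟨e, he⟩ := hR
  obtain ⟨cp, hcp⟩ := OracleCode.exists_eval_of_computable
    (Primrec₂.natPair.to_comp.comp ha hb)
  obtain ⟨cs, hcs⟩ := OracleCode.exists_eval_of_computable hs
  obtain ⟨ct, hct⟩ := OracleCode.exists_eval_of_computable ht
  obtain ⟨ci, hci⟩ := OracleCode.exists_eval_of_computable (Computable.const (α := ℕ) i)
  obtain ⟨cid, hcid⟩ := OracleCode.exists_eval_of_computable (Computable.id (α := ℕ))
  let W := OracleCode.pair cid (OracleCode.comp OracleCode.oracle ci)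
  let c := OracleCode.comp cs (OracleCode.pair OracleCode.left (OracleCode.comp .oracle ct))
  have hW : ∀ g x, W.eval g x = Part.some (Nat.pair x (g i)) := fun g x =>
    OracleCode.eval_pair_of_eq (hcid g x) (by
      rw [OracleCode.eval_comp_of_eq (hci g x)]; rfl)
  refine ⟨.comp (.subst c e) (.comp (.pair cid cp) W), fun F x y => ?_⟩
  set w := Nat.pair (Nat.pair x y) (joinTuple F i) with hw
  have hc : ∀ k, c.eval (joinTuple F) (Nat.pair w k) = Part.some (joinTuple (Θ w F) k) := by
    intro k
    have h1 : (OracleCode.left).eval (joinTuple F) (Nat.pair w k) = Part.some w := by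
      simp [OracleCode.eval]
    have h2 : (OracleCode.comp .oracle ct).eval (joinTuple F) (Nat.pair w k) =
        Part.some (joinTuple F (t (Nat.pair w k))) := by
      rw [OracleCode.eval_comp_of_eq (hct _ _)]; rfl
    rw [OracleCode.eval_comp_of_eq (OracleCode.eval_pair_of_eq h1 h2), hcs, hΘ]
  have hq : (OracleCode.comp (.pair cid cp) W).eval (joinTuple F) (Nat.pair x y) =
      Part.some (Nat.pair w (Nat.pair (a w) (b w))) := by
    rw [OracleCode.eval_comp_of_eq (hW _ _), ← hw]
    exact OracleCode.eval_pair_of_eq (hcid _ _) (hcp _ _)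
  rw [OracleCode.eval_comp_of_eq hq, OracleCode.eval_subst hc]
  exact he (Θ w F) (a w) (b w)

theorem IsRecursivePredicate.not {R : ℕ → ℕ → (Fin n → ℕ → ℕ) → Prop}
    (hR : IsRecursivePredicate R) : IsRecursivePredicate fun x y F => ¬ R x y F := by
  obtain ⟨e, he⟩ := hR
  obtain ⟨c, hc⟩ := OracleCode.exists_eval_of_computable
    (h := fun v => if v = 1 then 0 else 1)
    (Primrec.ite (Primrec.eq.comp .id (.const 1)) (.const 0) (.const 1)).to_comp
  refine ⟨.comp c e, fun F x y => ?_⟩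
  obtain ⟨v, hv, h⟩ := he F x y
  rw [OracleCode.eval_comp_of_eq (Part.eq_some_iff.2 hv), hc]
  refine ⟨_, Part.mem_some _, ?_⟩
  by_cases hv1 : v = 1 <;> simp [h, hv1]

theorem IsRecursivePredicate.ite {p : ℕ → Prop} (hp : ComputablePred p)
    {R S : ℕ → ℕ → (Fin n → ℕ → ℕ) → Prop}
    (hR : IsRecursivePredicate R) (hS : IsRecursivePredicate S) :
    IsRecursivePredicate fun x y F => (p x ∧ R x y F) ∨ (¬ p x ∧ S x y F) := by
  classical
  obtain ⟨e, he⟩ := hR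
  obtain ⟨e', he'⟩ := hS
  have hpd := ComputablePred.decide hp
  obtain ⟨c, hc⟩ := OracleCode.exists_eval_of_computable
    (h := fun z => bif decide (p z.unpair.1.unpair.1) then z.unpair.2.unpair.1
      else z.unpair.2.unpair.2)
    (Computable.cond (hpd.comp ((Computable.fst.comp .unpair).comp (Computable.fst.comp .unpair)))
      ((Computable.fst.comp .unpair).comp (Computable.snd.comp .unpair))
      ((Computable.snd.comp .unpair).comp (Computable.snd.comp .unpair)))
  obtain ⟨cid, hcid⟩ := OracleCode.exists_eval_of_computable (Computable.id (α := ℕ))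
  refine ⟨.comp c (.pair cid (.pair e e')), fun F x y => ?_⟩
  obtain ⟨v, hv, h⟩ := he F x y
  obtain ⟨v', hv', h'⟩ := he' F x y
  rw [OracleCode.eval_comp_of_eq (OracleCode.eval_pair_of_eq (hcid _ _)
    (OracleCode.eval_pair_of_eq (Part.eq_some_iff.2 hv) (Part.eq_some_iff.2 hv'))), hc]
  refine ⟨_, Part.mem_some _, ?_⟩
  by_cases hpx : p x <;> simp [hpx, h, h']

theorem IsRecursivePredicate.and {R S : ℕ → ℕ → (Fin n → ℕ → ℕ) → Prop}
    (hR : IsRecursivePredicate R) (hS : IsRecursivePredicate S) :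
    IsRecursivePredicate fun x y F => R x y F ∧ S x y F := by
  obtain ⟨e, he⟩ := hR
  obtain ⟨e', he'⟩ := hS
  obtain ⟨c, hc⟩ := OracleCode.exists_eval_of_computable
    (h := fun z => if z.unpair.1 = 1 then z.unpair.2 else 0)
    (Primrec.ite (Primrec.eq.comp (Primrec.fst.comp .unpair) (.const 1))
      (Primrec.snd.comp .unpair) (.const 0)).to_comp
  refine ⟨.comp c (.pair e e'), fun F x y => ?_⟩
  obtain ⟨v, hv, h⟩ := he F x y
  obtain ⟨v', hv', h'⟩ := he' F x y
  rw [OracleCode.eval_comp_of_eq (OracleCode.eval_pair_of_eq (Part.eq_some_iff.2 hv)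
    (Part.eq_some_iff.2 hv')), hc]
  refine ⟨_, Part.mem_some _, ?_⟩
  by_cases hpx : v = 1 <;> simp [hpx, h, h']

theorem IsRecursivePredicate.of_computablePred {p : ℕ → Prop} (hp : ComputablePred p) :
    IsRecursivePredicate (n := n) fun x _ _ => p x := by
  classical
  have hpd := ComputablePred.decide hp
  obtain ⟨c, hc⟩ := OracleCode.exists_eval_of_computable
    (h := fun z => bif decide (p z.unpair.1) then 1 else 0)
    (Computable.cond (hpd.comp (Computable.fst.comp .unpair)) (.const 1) (.const 0))
  refine ⟨c, fun F x y => ?_⟩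
  rw [hc]
  refine ⟨_, Part.mem_some _, ?_⟩
  by_cases hpx : p x <;> simp [hpx]

end Recursive

-- Manipulation of quantifier prefixes.

section Prefix

theorem prefix_not (n : ℕ) : ∀ P : ℕ → (Fin n → ℕ → ℕ) → Prop,
    ((¬ existsPrefix n P) ↔ forallPrefix n fun y F => ¬ P y F) ∧
    ((¬ forallPrefix n P) ↔ existsPrefix n fun y F => ¬ P y F) := by
  induction n with
  | zero => intro P; simp [existsPrefix, forallPrefix]
  | succ n ih =>
    intro P
    simp only [existsPrefix, forallPrefix, not_exists, not_forall, (ih _).1, (ih _).2, and_self]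

theorem prefix_const (n : ℕ) (p : Prop) :
    (existsPrefix n (fun _ _ => p) ↔ p) ∧ (forallPrefix n (fun _ _ => p) ↔ p) := by
  induction n with
  | zero => simp [existsPrefix, forallPrefix]
  | succ n ih => simp [existsPrefix, forallPrefix, ih]

theorem cons_map {n : ℕ} (g : (ℕ → ℕ) → ℕ → ℕ) (f : ℕ → ℕ) (F : Fin n → ℕ → ℕ) :
    (fun i => g ((Fin.cons f F : Fin (n + 1) → ℕ → ℕ) i)) =
      (Fin.cons (g f) (fun i => g (F i)) : Fin (n + 1) → ℕ → ℕ) := by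
  funext i
  induction i using Fin.cases <;> rfl

/-- The tuple of the first components of the values. -/
def fstTuple {n : ℕ} (F : Fin n → ℕ → ℕ) : Fin n → ℕ → ℕ := fun i k => (F i k).unpair.1

/-- The tuple of the second components of the values. -/
def sndTuple {n : ℕ} (F : Fin n → ℕ → ℕ) : Fin n → ℕ → ℕ := fun i k => (F i k).unpair.2

theorem fstTuple_cons {n : ℕ} (f : ℕ → ℕ) (F : Fin n → ℕ → ℕ) :
    fstTuple (Fin.cons f F : Fin (n + 1) → ℕ → ℕ) =
      (Fin.cons (fun k => (f k).unpair.1) (fstTuple F) : Fin (n + 1) → ℕ → ℕ) :=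
  cons_map (fun f k => (f k).unpair.1) f F

theorem sndTuple_cons {n : ℕ} (f : ℕ → ℕ) (F : Fin n → ℕ → ℕ) :
    sndTuple (Fin.cons f F : Fin (n + 1) → ℕ → ℕ) =
      (Fin.cons (fun k => (f k).unpair.2) (sndTuple F) : Fin (n + 1) → ℕ → ℕ) :=
  cons_map (fun f k => (f k).unpair.2) f F

/-- One prefix serves both conjuncts when each quantified object codes a pair. The two kinds of
prefix go together because peeling off a quantifier exchanges them. -/
theorem prefix_and (n : ℕ) : ∀ P Q : ℕ → (Fin n → ℕ → ℕ) → Prop,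
    (existsPrefix n (fun y F => P y.unpair.1 (fstTuple F) ∧ Q y.unpair.2 (sndTuple F)) ↔
      existsPrefix n P ∧ existsPrefix n Q) ∧
    (forallPrefix n (fun y F => P y.unpair.1 (fstTuple F) ∧ Q y.unpair.2 (sndTuple F)) ↔
      forallPrefix n P ∧ forallPrefix n Q) := by
  induction n with
  | zero =>
    intro P Q
    have h : ∀ F : Fin 0 → ℕ → ℕ, F = Fin.elim0 := fun F => Subsingleton.elim _ _
    simp only [existsPrefix, forallPrefix, h (fstTuple _), h (sndTuple _)]
    refine ⟨⟨fun ⟨y, h₁, h₂⟩ => ⟨⟨_, h₁⟩, ⟨_, h₂⟩⟩, fun ⟨⟨y, h₁⟩, ⟨z, h₂⟩⟩ => ⟨Nat.pair y z, ?_⟩⟩,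
      fun H => ⟨fun y => ?_, fun y => ?_⟩, fun H y => ⟨H.1 _, H.2 _⟩⟩
    · simpa using ⟨h₁, h₂⟩
    · simpa using (H (Nat.pair y 0)).1
    · simpa using (H (Nat.pair 0 y)).2
  | succ n ih =>
    intro P Q
    simp only [existsPrefix, forallPrefix, fstTuple_cons, sndTuple_cons]
    constructor
    · refine (exists_congr fun f : ℕ → ℕ => (ih
        (fun y F => P y (Fin.cons (fun k => (f k).unpair.1) F))
        (fun y F => Q y (Fin.cons (fun k => (f k).unpair.2) F))).2).trans ?_
      refine ⟨fun ⟨f, h₁, h₂⟩ => ⟨⟨_, h₁⟩, ⟨_, h₂⟩⟩,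
        fun ⟨⟨f, h₁⟩, ⟨g, h₂⟩⟩ => ⟨fun k => Nat.pair (f k) (g k), ?_⟩⟩
      simpa using ⟨h₁, h₂⟩
    · refine (forall_congr' fun f : ℕ → ℕ => (ih
        (fun y F => P y (Fin.cons (fun k => (f k).unpair.1) F))
        (fun y F => Q y (Fin.cons (fun k => (f k).unpair.2) F))).1).trans ?_
      refine ⟨fun H => ⟨fun f => ?_, fun f => ?_⟩, fun H y => ⟨H.1 _, H.2 _⟩⟩
      · simpa using (H fun k => Nat.pair (f k) 0).1
      · simpa using (H fun k => Nat.pair 0 (f k)).2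

end Prefix

-- Positions in the join of a tuple.

section JoinTuple

theorem joinTuple_add_mul {m : ℕ} (F : Fin (m + 1) → ℕ → ℕ) (i : Fin (m + 1)) (q : ℕ) :
    joinTuple F (i + (m + 1) * q) = F i q := by
  have h₁ : ((i : ℕ) + (m + 1) * q) % (m + 1) = i := by
    rw [Nat.add_mul_mod_self_left, Nat.mod_eq_of_lt i.2]
  have h₂ : ((i : ℕ) + (m + 1) * q) / (m + 1) = q := by
    rw [Nat.add_mul_div_left _ _ m.succ_pos, Nat.div_eq_of_lt i.2, zero_add]
  simp only [joinTuple, h₁, h₂]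

theorem joinTuple_val {m : ℕ} (F : Fin (m + 1) → ℕ → ℕ) (i : Fin (m + 1)) :
    joinTuple F i = F i 0 := by
  simpa using joinTuple_add_mul F i 0

theorem exists_eq_add_mul (m k : ℕ) : ∃ (i : Fin (m + 1)) (q : ℕ), k = i + (m + 1) * q :=
  ⟨⟨k % (m + 1), Nat.mod_lt _ m.succ_pos⟩, k / (m + 1), (Nat.mod_add_div _ _).symm⟩

theorem joinTuple_map {n : ℕ} (g : ℕ → ℕ) (hg : g 0 = 0) (F : Fin n → ℕ → ℕ) (k : ℕ) :
    joinTuple (fun i k => g (F i k)) k = g (joinTuple F k) := by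
  cases n with
  | zero => exact hg.symm
  | succ n => rfl

end JoinTuple

-- Closure properties of `Σ¹ₙ` sets.

section Sigma

variable {n : ℕ} {X Y : Set ℕ}

theorem computable_fst : Computable fun z : ℕ => z.unpair.1 := Computable.fst.comp .unpair

theorem computable_snd : Computable fun z : ℕ => z.unpair.2 := Computable.snd.comp .unpair

theorem compl_mem_piOne_iff : Xᶜ ∈ PiOne n ↔ X ∈ SigmaOne n := by
  constructor
  · rintro ⟨R, hR, h⟩
    refine ⟨_, hR.not, fun x => ?_⟩
    rw [← (prefix_not n _).2, ← h, Set.mem_compl_iff, not_not]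
  · rintro ⟨R, hR, h⟩
    refine ⟨_, hR.not, fun x => ?_⟩
    rw [← (prefix_not n _).1, ← h, Set.mem_compl_iff]

theorem compl_mem_sigmaOne_iff : Xᶜ ∈ SigmaOne n ↔ X ∈ PiOne n := by
  rw [← compl_mem_piOne_iff, compl_compl]

theorem mem_deltaOne_iff : X ∈ DeltaOne n ↔ X ∈ SigmaOne n ∧ Xᶜ ∈ SigmaOne n := by
  rw [compl_mem_sigmaOne_iff]; rfl

theorem sigmaOne_preimage (hX : X ∈ SigmaOne n) {h : ℕ → ℕ} (hh : Computable h) :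
    h ⁻¹' X ∈ SigmaOne n := by
  obtain ⟨R, hR, hRX⟩ := hX
  refine ⟨fun x y F => R (h x) y F, ?_, fun x => hRX _⟩
  have := hR.subst (m := n) (a := fun w => h w.unpair.1.unpair.1) (b := fun w => w.unpair.1.unpair.2)
    (s := fun w => w.unpair.2) (t := fun w => w.unpair.2)
    (hh.comp (computable_fst.comp computable_fst)) (computable_snd.comp computable_fst)
    computable_snd computable_snd 0 (fun _ F => F) (by simp)
  simpa using this

theorem sigmaOne_inter (hX : X ∈ SigmaOne n) (hY : Y ∈ SigmaOne n) : X ∩ Y ∈ SigmaOne n := by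
  obtain ⟨R, hR, hRX⟩ := hX
  obtain ⟨S, hS, hSY⟩ := hY
  refine ⟨fun x y F => R x y.unpair.1 (fstTuple F) ∧ S x y.unpair.2 (sndTuple F), ?_, fun x => ?_⟩
  · have h₁ := hR.subst (m := n) (a := fun w => w.unpair.1.unpair.1)
      (b := fun w => w.unpair.1.unpair.2.unpair.1)
      (s := fun w => w.unpair.2.unpair.1) (t := fun w => w.unpair.2)
      (computable_fst.comp computable_fst)
      (computable_fst.comp (computable_snd.comp computable_fst))
      (computable_fst.comp computable_snd) computable_snd 0 (fun _ F => fstTuple F)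
      (fun w F k => by
        simp only [Nat.unpair_pair]
        exact joinTuple_map (fun v => v.unpair.1) (by simp) F k)
    have h₂ := hS.subst (m := n) (a := fun w => w.unpair.1.unpair.1)
      (b := fun w => w.unpair.1.unpair.2.unpair.2)
      (s := fun w => w.unpair.2.unpair.2) (t := fun w => w.unpair.2)
      (computable_fst.comp computable_fst)
      (computable_snd.comp (computable_snd.comp computable_fst))
      (computable_snd.comp computable_snd) computable_snd 0 (fun _ F => sndTuple F)
      (fun w F k => by
        simp only [Nat.unpair_pair]
        exact joinTuple_map (fun v => v.unpair.2) (by simp) F k)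
    simpa using h₁.and h₂
  · rw [(prefix_and n _ _).1, Set.mem_inter_iff, hRX, hSY]

theorem sigmaOne_ite (hX : X ∈ SigmaOne n) (hY : Y ∈ SigmaOne n) {p : ℕ → Prop}
    (hp : ComputablePred p) : {x | (p x ∧ x ∈ X) ∨ (¬ p x ∧ x ∈ Y)} ∈ SigmaOne n := by
  obtain ⟨R, hR, hRX⟩ := hX
  obtain ⟨S, hS, hSY⟩ := hY
  refine ⟨_, hR.ite hp hS, fun x => ?_⟩
  by_cases h : p x <;> simp [h, hRX, hSY]

theorem setOf_mem_sigmaOne {p : ℕ → Prop} (hp : ComputablePred p) : {x | p x} ∈ SigmaOne n :=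
  ⟨_, .of_computablePred hp, fun x => ((prefix_const n (p x)).1).symm⟩

/-- The number quantifier is absorbed by the leading function quantifier: the witness becomes the
value at `0`, and the old function is shifted by one. -/
theorem sigmaOne_exists {m : ℕ} (hX : X ∈ SigmaOne (m + 1)) :
    {x | ∃ y, Nat.pair x y ∈ X} ∈ SigmaOne (m + 1) := by
  obtain ⟨R, hR, hRX⟩ := hX
  let Θ : (Fin (m + 1) → ℕ → ℕ) → Fin (m + 1) → ℕ → ℕ := fun F =>
    Fin.cons (fun k => F 0 (k + 1)) (Fin.tail F)
  refine ⟨fun x y F => R (Nat.pair x (F 0 0)) y (Θ F), ?_, fun x => ?_⟩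
  · have := hR.subst (m := m + 1) (a := fun w => Nat.pair w.unpair.1.unpair.1 w.unpair.2)
      (b := fun w => w.unpair.1.unpair.2) (s := fun w => w.unpair.2)
      -- A shift by one in component `0` is a shift by `m + 1` in the join.
      (t := fun w => if w.unpair.2 % (m + 1) = 0 then w.unpair.2 + (m + 1) else w.unpair.2)
      (Primrec₂.natPair.to_comp.comp (computable_fst.comp computable_fst) computable_snd)
      (computable_snd.comp computable_fst) computable_snd
      (Primrec.ite (Primrec.eq.comp
        (Primrec.nat_mod.comp (Primrec.snd.comp .unpair) (.const _)) (.const 0))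
        (Primrec.nat_add.comp (Primrec.snd.comp .unpair) (.const _))
        (Primrec.snd.comp .unpair)).to_comp
      0 (fun _ F => Θ F) (fun w F k => ?_)
    · simpa [show ∀ F : Fin (m + 1) → ℕ → ℕ, joinTuple F 0 = F 0 0 from
        fun F => joinTuple_val F 0] using this
    · obtain ⟨i, q, rfl⟩ := exists_eq_add_mul m k
      simp only [Nat.unpair_pair]
      rw [Nat.add_mul_mod_self_left, Nat.mod_eq_of_lt i.2, joinTuple_add_mul]
      induction i using Fin.cases with
      | zero =>
        have := joinTuple_add_mul F 0 (q + 1)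
        simp only [Fin.val_zero, zero_add, mul_add, mul_one] at this
        simp [Θ, this]
      | succ i =>
        have := joinTuple_add_mul F i.succ q
        rw [if_neg (by simp), this]
        rfl
  · simp only [Set.mem_ofPred_eq, hRX, existsPrefix]
    constructor
    · rintro ⟨y, f, h⟩
      refine ⟨fun k => k.casesOn y f, ?_⟩
      simpa [Θ] using h
    · rintro ⟨f, h⟩
      refine ⟨f 0, fun k => f (k + 1), ?_⟩
      simpa [Θ] using h

/-- By choice, the functions for all `y` are the sections of a single function; the number
quantifier then joins the universal number quantifier of the matrix. -/
theorem sigmaOne_one_forall (hX : X ∈ SigmaOne 1) :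
    {x | ∀ y, Nat.pair x y ∈ X} ∈ SigmaOne 1 := by
  obtain ⟨R, hR, hRX⟩ := hX
  refine ⟨fun x y F => R (Nat.pair x y.unpair.1) y.unpair.2
    (fun i k => F i (Nat.pair y.unpair.1 k)), ?_, fun x => ?_⟩
  · have := hR.subst (m := 1)
      (a := fun w => Nat.pair w.unpair.1.unpair.1 w.unpair.1.unpair.2.unpair.1)
      (b := fun w => w.unpair.1.unpair.2.unpair.2) (s := fun w => w.unpair.2)
      (t := fun w => Nat.pair w.unpair.1.unpair.1.unpair.2.unpair.1 w.unpair.2)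
      (Primrec₂.natPair.to_comp.comp (computable_fst.comp computable_fst)
        (computable_fst.comp (computable_snd.comp computable_fst)))
      (computable_snd.comp (computable_snd.comp computable_fst)) computable_snd
      (Primrec₂.natPair.to_comp.comp (computable_fst.comp (computable_snd.comp
        (computable_fst.comp computable_fst))) computable_snd)
      0 (fun w F i k => F i (Nat.pair w.unpair.1.unpair.2.unpair.1 k)) (fun w F k => ?_)
    · simpa using this
    · simp [joinTuple, Nat.mod_one]
  · simp only [Set.mem_ofPred_eq, hRX, existsPrefix, forallPrefix]
    have hc : ∀ (f : ℕ → ℕ) (z : ℕ), (fun (i : Fin 1) k =>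
        (Fin.cons f Fin.elim0 : Fin 1 → ℕ → ℕ) i (Nat.pair z k)) =
        (Fin.cons (fun k => f (Nat.pair z k)) Fin.elim0 : Fin 1 → ℕ → ℕ) := by
      intro f z
      funext i
      rw [Subsingleton.elim i 0]
      rfl
    simp only [hc]
    constructor
    · intro h
      choose f hf using h
      refine ⟨fun k => f k.unpair.1 k.unpair.2, fun y => ?_⟩
      simpa using hf y.unpair.1 y.unpair.2
    · rintro ⟨f, h⟩ z
      refine ⟨fun k => f (Nat.pair z k), fun y => ?_⟩
      simpa using h (Nat.pair z y)

/-- Again the first function collects the witnesses for all numbers as sections, but the number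
itself is now stored as the value at `0` of the second, universally quantified, function. -/
theorem sigmaOne_add_two_forall {m : ℕ} (hX : X ∈ SigmaOne (m + 2)) :
    {x | ∀ y, Nat.pair x y ∈ X} ∈ SigmaOne (m + 2) := by
  obtain ⟨R, hR, hRX⟩ := hX
  let Θ : ℕ → (Fin (m + 2) → ℕ → ℕ) → Fin (m + 2) → ℕ → ℕ := fun z F =>
    Fin.cons (fun k => F 0 (Nat.pair z k))
      (Fin.cons (fun k => F 1 (k + 1)) (Fin.tail (Fin.tail F)) : Fin (m + 1) → ℕ → ℕ)
  refine ⟨fun x y F => R (Nat.pair x (F 1 0)) y (Θ (F 1 0) F), ?_, fun x => ?_⟩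
  · have := hR.subst (m := m + 2) (a := fun w => Nat.pair w.unpair.1.unpair.1 w.unpair.2)
      (b := fun w => w.unpair.1.unpair.2) (s := fun w => w.unpair.2)
      (t := fun w => if w.unpair.2 % (m + 2) = 0 then
          (m + 2) * Nat.pair w.unpair.1.unpair.2 (w.unpair.2 / (m + 2))
        else if w.unpair.2 % (m + 2) = 1 then w.unpair.2 + (m + 2) else w.unpair.2)
      (Primrec₂.natPair.to_comp.comp (computable_fst.comp computable_fst) computable_snd)
      (computable_snd.comp computable_fst) computable_snd
      (Primrec.ite (Primrec.eq.comp
        (Primrec.nat_mod.comp (Primrec.snd.comp .unpair) (.const _)) (.const 0))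
        (Primrec.nat_mul.comp (.const _) (Primrec₂.natPair.comp
          (Primrec.snd.comp (Primrec.unpair.comp (Primrec.fst.comp .unpair)))
          (Primrec.nat_div.comp (Primrec.snd.comp .unpair) (.const _))))
        (Primrec.ite (Primrec.eq.comp
          (Primrec.nat_mod.comp (Primrec.snd.comp .unpair) (.const _)) (.const 1))
          (Primrec.nat_add.comp (Primrec.snd.comp .unpair) (.const _))
          (Primrec.snd.comp .unpair))).to_comp
      1 (fun w F => Θ w.unpair.2 F) (fun w F k => ?_)
    · simpa [show ∀ F : Fin (m + 2) → ℕ → ℕ, joinTuple F 1 = F 1 0 from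
        fun F => by simpa using joinTuple_val F 1] using this
    · obtain ⟨i, q, rfl⟩ := exists_eq_add_mul (m + 1) k
      have hmod : (i + (m + 1 + 1) * q) % (m + 2) = i := by
        rw [Nat.add_mul_mod_self_left, Nat.mod_eq_of_lt i.2]
      have hdiv : (i + (m + 1 + 1) * q) / (m + 2) = q := by
        rw [Nat.add_mul_div_left _ _ (m + 1).succ_pos, Nat.div_eq_of_lt i.2, zero_add]
      simp only [Nat.unpair_pair, hmod, hdiv]
      rw [joinTuple_add_mul]
      induction i using Fin.cases with
      | zero =>
        have := joinTuple_add_mul F 0 (Nat.pair w.unpair.2 q)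
        simp only [Fin.val_zero, zero_add] at this
        simp [Θ, this]
      | succ i =>
        rw [if_neg (by simp)]
        induction i using Fin.cases with
        | zero =>
          have := joinTuple_add_mul F 1 (q + 1)
          simp only [Fin.val_one, mul_add, mul_one, ← add_assoc] at this
          rw [if_pos (by simp)]
          simpa [Θ, add_assoc] using this.symm
        | succ i =>
          have := joinTuple_add_mul F i.succ.succ q
          rw [if_neg (by simp), this]
          rfl
  · simp only [Set.mem_ofPred_eq, hRX, existsPrefix, forallPrefix]
    constructor
    · intro h
      choose f hf using h
      refine ⟨fun k => f k.unpair.1 k.unpair.2, fun g => ?_⟩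
      simpa [Θ] using hf (g 0) fun k => g (k + 1)
    · rintro ⟨f, h⟩ z
      refine ⟨fun k => f (Nat.pair z k), fun g => ?_⟩
      simpa [Θ] using h fun k => k.casesOn z g

theorem sigmaOne_forall {m : ℕ} (hX : X ∈ SigmaOne (m + 1)) :
    {x | ∀ y, Nat.pair x y ∈ X} ∈ SigmaOne (m + 1) := by
  cases m with
  | zero => exact sigmaOne_one_forall hX
  | succ m => exact sigmaOne_add_two_forall hX

end Sigma

section

open Encodable

attribute [fun_prop] Computable Computable.fst Computable.snd Computable.const
  Computable.unpair

@[fun_prop]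
theorem computable_id' {α : Type*} [Primcodable α] : Computable fun a : α => a := Computable.id

@[fun_prop]
theorem computable_comp' {α β γ : Type*} [Primcodable α] [Primcodable β] [Primcodable γ]
    {f : β → γ} {g : α → β} (hf : Computable f) (hg : Computable g) :
    Computable fun a => f (g a) := hf.comp hg

@[fun_prop]
theorem computable_prodMk {α β γ : Type*} [Primcodable α] [Primcodable β] [Primcodable γ]
    {f : α → β} {g : α → γ} (hf : Computable f) (hg : Computable g) :
    Computable fun a => (f a, g a) := hf.pair hg

@[fun_prop]
theorem computable_add : Computable fun z : ℕ × ℕ => z.1 + z.2 := Primrec.nat_add.to_comp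

-- Closure properties of `Δ¹ₙ` sets, predicates and functions.

section Delta

variable {m : ℕ} {X Y : Set ℕ}

/-- A union is an existential quantifier over which of the two sets is meant. -/
theorem sigmaOne_union (hX : X ∈ SigmaOne (m + 1)) (hY : Y ∈ SigmaOne (m + 1)) :
    X ∪ Y ∈ SigmaOne (m + 1) := by
  have h := sigmaOne_exists (sigmaOne_ite (sigmaOne_preimage hX computable_fst)
    (sigmaOne_preimage hY computable_fst) (p := fun z => z.unpair.2 = 0)
    (Primrec.eq.comp (Primrec.snd.comp .unpair) (.const 0)).computablePred)
  convert! h using 1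
  ext x
  simp only [Set.mem_union, Set.mem_ofPred_eq, Set.mem_preimage, Nat.unpair_pair]
  refine ⟨?_, ?_⟩
  · rintro (h | h)
    · exact ⟨0, .inl ⟨rfl, h⟩⟩
    · exact ⟨1, .inr ⟨one_ne_zero, h⟩⟩
  · rintro ⟨i, h | h⟩
    · exact .inl h.2
    · exact .inr h.2

theorem deltaOne_compl (hX : X ∈ DeltaOne m) : Xᶜ ∈ DeltaOne m := by
  rw [mem_deltaOne_iff] at *
  simpa using hX.symm

theorem deltaOne_inter (hX : X ∈ DeltaOne (m + 1)) (hY : Y ∈ DeltaOne (m + 1)) :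
    X ∩ Y ∈ DeltaOne (m + 1) := by
  rw [mem_deltaOne_iff] at *
  rw [Set.compl_inter]
  exact ⟨sigmaOne_inter hX.1 hY.1, sigmaOne_union hX.2 hY.2⟩

theorem deltaOne_preimage (hX : X ∈ DeltaOne m) {h : ℕ → ℕ} (hh : Computable h) :
    h ⁻¹' X ∈ DeltaOne m := by
  rw [mem_deltaOne_iff] at *
  exact ⟨sigmaOne_preimage hX.1 hh, sigmaOne_preimage hX.2 hh⟩

theorem deltaOne_exists (hX : X ∈ DeltaOne (m + 1)) :
    {x | ∃ y, Nat.pair x y ∈ X} ∈ DeltaOne (m + 1) := by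
  rw [mem_deltaOne_iff] at *
  refine ⟨sigmaOne_exists hX.1, ?_⟩
  convert! sigmaOne_forall hX.2 using 1
  ext x
  simp

theorem setOf_mem_deltaOne {p : ℕ → Prop} (hp : ComputablePred p) :
    {x | p x} ∈ DeltaOne m :=
  mem_deltaOne_iff.2 ⟨setOf_mem_sigmaOne hp, setOf_mem_sigmaOne hp.not⟩

end Delta

/-- A predicate on an effectively coded type is `Δ¹ₙ` if it agrees with a `Δ¹ₙ` set of codes. -/
def DeltaPred (n : ℕ) {α : Type*} [Primcodable α] (p : α → Prop) : Prop :=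
  ∃ X ∈ DeltaOne n, ∀ a, p a ↔ encode a ∈ X

/-- A function is `Δ¹ₙ` if its graph is. -/
def DeltaFun (n : ℕ) {α : Type*} [Primcodable α] (f : α → ℕ) : Prop :=
  DeltaPred n fun z : α × ℕ => f z.1 = z.2

namespace DeltaPred

variable {m n : ℕ} {α β : Type*} [Primcodable α] [Primcodable β] {p q : α → Prop}

theorem of_eq (hp : DeltaPred n p) (h : ∀ a, p a ↔ q a) : DeltaPred n q :=
  (funext fun a => propext (h a) : p = q) ▸ hp

theorem comp (hp : DeltaPred n p) {f : β → α} (hf : Computable f) :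
    DeltaPred n fun b => p (f b) := by
  obtain ⟨X, hX, h⟩ := hp
  -- Encoding `some a` adds one to the code of `a`; the predecessor removes it.
  refine ⟨_, deltaOne_preimage hX (h := fun k => (encode ((decode k : Option β).map f)).pred)
    (Computable.pred.comp (Computable.encode.comp
      (Computable.option_map .decode (hf.comp .snd)))), fun b => ?_⟩
  simp [h]

theorem of_computablePred (hp : ComputablePred p) : DeltaPred n p := by
  classical
  refine ⟨_, setOf_mem_deltaOne (p := fun k => ((decode k : Option α).map
    (fun a => decide (p a))).getD false = true) ?_, fun a => by simp⟩
  refine ComputablePred.of_eq (p := fun k => (((decode k : Option α).map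
    (fun a => decide (p a))).getD false : Prop)) ?_ fun _ => Iff.rfl
  exact ComputablePred.computable_iff.2 ⟨_, Computable.option_getD
    (Computable.option_map (g := fun (_ : ℕ) a => decide (p a)) .decode (hp.decide.comp .snd))
    (.const false), rfl⟩

theorem not (hp : DeltaPred n p) : DeltaPred n fun a => ¬ p a := by
  obtain ⟨X, hX, h⟩ := hp
  exact ⟨_, deltaOne_compl hX, fun a => by simp [h]⟩

theorem and (hp : DeltaPred (m + 1) p) (hq : DeltaPred (m + 1) q) :
    DeltaPred (m + 1) fun a => p a ∧ q a := by
  obtain ⟨X, hX, h⟩ := hp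
  obtain ⟨Y, hY, h'⟩ := hq
  exact ⟨_, deltaOne_inter hX hY, fun a => by simp [h, h']⟩

theorem or (hp : DeltaPred (m + 1) p) (hq : DeltaPred (m + 1) q) :
    DeltaPred (m + 1) fun a => p a ∨ q a :=
  (hp.not.and hq.not).not.of_eq fun a => by tauto

theorem imp (hp : DeltaPred (m + 1) p) (hq : DeltaPred (m + 1) q) :
    DeltaPred (m + 1) fun a => p a → q a :=
  (hp.not.or hq).of_eq fun a => by tauto

theorem exists_nat {r : α → ℕ → Prop} (hr : DeltaPred (m + 1) fun z : α × ℕ => r z.1 z.2) :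
    DeltaPred (m + 1) fun a => ∃ k, r a k := by
  obtain ⟨X, hX, h⟩ := hr
  refine ⟨_, deltaOne_exists hX, fun a => ?_⟩
  exact exists_congr fun k => by simpa using h (a, k)

theorem forall_nat {r : α → ℕ → Prop} (hr : DeltaPred (m + 1) fun z : α × ℕ => r z.1 z.2) :
    DeltaPred (m + 1) fun a => ∀ k, r a k :=
  (exists_nat (r := fun a k => ¬ r a k) hr.not).not.of_eq fun a => by simp

theorem nat_le {f g : α → ℕ} (hf : Computable f) (hg : Computable g) :
    DeltaPred n fun a => f a ≤ g a :=
  (of_computablePred (p := fun z : ℕ × ℕ => z.1 ≤ z.2)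
    (Primrec.nat_le.comp .fst .snd).computablePred).comp (hf.pair hg)

theorem nat_eq {f g : α → ℕ} (hf : Computable f) (hg : Computable g) :
    DeltaPred n fun a => f a = g a :=
  (of_computablePred (p := fun z : ℕ × ℕ => z.1 = z.2)
    (Primrec.eq.comp .fst .snd).computablePred).comp (hf.pair hg)

/-- Substitution of a `Δ¹ₙ` function into a `Δ¹ₙ` predicate. -/
theorem subst {r : α → ℕ → Prop} (hr : DeltaPred (m + 1) fun z : α × ℕ => r z.1 z.2)
    {f : α → ℕ} (hf : DeltaFun (m + 1) f) : DeltaPred (m + 1) fun a => r a (f a) :=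
  (exists_nat (r := fun a k => f a = k ∧ r a k) (DeltaPred.and hf hr)).of_eq fun a => by simp

open Nat.Partrec (Code) in
theorem mem_eval {e a b : α → ℕ} (he : Computable e) (ha : Computable a) (hb : Computable b) :
    DeltaPred (m + 1) fun x => b x ∈ (Denumerable.ofNat Code (e x)).eval (a x) := by
  have h : ComputablePred fun z : ((ℕ × ℕ) × ℕ) × ℕ =>
      Code.evaln z.2 (Denumerable.ofNat Code z.1.1.1) z.1.1.2 = some z.1.2 :=
    (Primrec.eq.comp (Code.primrec_evaln.comp (((Primrec.snd).pair ((Primrec.ofNat Code).comp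
      (Primrec.fst.comp (Primrec.fst.comp .fst)))).pair
        (Primrec.snd.comp (Primrec.fst.comp .fst))))
      (Primrec.option_some.comp (Primrec.snd.comp .fst))).computablePred
  exact ((exists_nat (r := fun (z : (ℕ × ℕ) × ℕ) k =>
      Code.evaln k (Denumerable.ofNat Code z.1.1) z.1.2 = some z.2) (of_computablePred h)).comp
    ((he.pair ha).pair hb)).of_eq fun x => Code.evaln_complete.symm

end DeltaPred

namespace DeltaFun

variable {m n : ℕ} {α β : Type*} [Primcodable α] [Primcodable β]

theorem of_computable {f : α → ℕ} (hf : Computable f) : DeltaFun n f :=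
  DeltaPred.nat_eq (hf.comp .fst) .snd

theorem comp_computable {f : α → ℕ} (hf : DeltaFun n f) {g : β → α} (hg : Computable g) :
    DeltaFun n fun b => f (g b) :=
  DeltaPred.comp (β := β × ℕ) hf (f := fun z => (g z.1, z.2)) ((hg.comp .fst).pair .snd)

theorem comp {g : ℕ → ℕ} {f : α → ℕ} (hg : DeltaFun (m + 1) g) (hf : DeltaFun (m + 1) f) :
    DeltaFun (m + 1) fun a => g (f a) :=
  DeltaPred.subst (α := α × ℕ) (r := fun z k => g k = z.2)
    (DeltaPred.comp hg (f := fun z : (α × ℕ) × ℕ => (z.2, z.1.2)) (by fun_prop))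
    (hf.comp_computable .fst)

theorem pair {f g : α → ℕ} (hf : DeltaFun (m + 1) f) (hg : DeltaFun (m + 1) g) :
    DeltaFun (m + 1) fun a => Nat.pair (f a) (g a) :=
  ((DeltaPred.comp hf (f := fun z : α × ℕ => (z.1, z.2.unpair.1)) (by fun_prop)).and
    (DeltaPred.comp hg (f := fun z : α × ℕ => (z.1, z.2.unpair.2)) (by fun_prop))).of_eq
    fun z => by
      constructor
      · rintro ⟨h₁, h₂⟩
        dsimp only at h₁ h₂ ⊢
        rw [h₁, h₂, Nat.pair_unpair]
      · intro h
        simp [← h]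

theorem ite {f g : α → ℕ} (hf : DeltaFun (m + 1) f) (hg : DeltaFun (m + 1) g) {p : α → Prop}
    [DecidablePred p] (hp : DeltaPred (m + 1) p) :
    DeltaFun (m + 1) fun a => if p a then f a else g a := by
  have hp' := hp.comp (f := (Prod.fst : α × ℕ → α)) .fst
  refine ((hp'.and hf).or (hp'.not.and hg)).of_eq fun z => ?_
  by_cases h : p z.1 <;> simp [h]

theorem sInf {r : α → ℕ → Prop} (hr : DeltaPred (m + 1) fun z : α × ℕ => r z.1 z.2) :
    DeltaFun (m + 1) fun a => sInf {k | r a k} := by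
  have hex : DeltaPred (m + 1) fun a => ∃ k, r a k := DeltaPred.exists_nat hr
  have hlow : DeltaPred (m + 1) fun z : α × ℕ => ∀ k, r z.1 k → z.2 ≤ k :=
    DeltaPred.forall_nat (r := fun (z : α × ℕ) k => r z.1 k → z.2 ≤ k)
      ((hr.comp (f := fun z : (α × ℕ) × ℕ => (z.1.1, z.2)) (by fun_prop)).imp
        (.nat_le (by fun_prop) (by fun_prop)))
  -- The second disjunct accounts for the value `0` of the infimum of the empty set.
  refine ((hr.and hlow).or ((hex.comp .fst).not.and
    (.nat_eq (f := fun z : α × ℕ => z.2) (g := fun _ => 0) (by fun_prop) (by fun_prop)))).of_eq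
    fun ⟨a, k⟩ => ?_
  by_cases h : ∃ k, r a k
  · have hmem : r a (InfSet.sInf {k | r a k}) := Nat.sInf_mem h
    simp only [h, not_true_eq_false, false_and, or_false]
    constructor
    · rintro ⟨h₁, h₂⟩
      exact le_antisymm (Nat.sInf_le h₁) (h₂ _ hmem)
    · rintro rfl
      exact ⟨hmem, fun k hk => Nat.sInf_le hk⟩
  · have h0 : {k | r a k} = ∅ := by
      ext k
      simpa using fun hk => h ⟨k, hk⟩
    have hno : ¬ r a k := fun hk => h ⟨k, hk⟩
    simp [h, h0, hno, eq_comm]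

/-- Finite sequences of numbers can be coded by numbers, with computable decoding. -/
theorem exists_sequence_coding : ∃ L : ℕ → ℕ → ℕ, (Computable fun z : ℕ × ℕ => L z.1 z.2) ∧
    ∀ (N : ℕ → ℕ) (s : ℕ), ∃ l, ∀ i, i ≤ s → L l i = N i := by
  refine ⟨fun l i => (Denumerable.ofNat (List ℕ) l).getD i 0,
    ((Primrec.list_getD 0).comp ((Primrec.ofNat _).comp .fst) .snd).to_comp, fun N s =>
    ⟨encode ((List.range (s + 1)).map N), fun i hi => ?_⟩⟩
  simp [List.getD_eq_getElem?_getD, List.getElem?_range (Nat.lt_succ_of_le hi)]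

/-- Primitive recursion preserves `Δ¹ₙ` functions. -/
theorem nat_rec {G : ℕ → ℕ → ℕ} (hG : DeltaFun (m + 1) fun z : ℕ × ℕ => G z.1 z.2) (c : ℕ) :
    DeltaFun (m + 1) fun s : ℕ => (Nat.rec c (fun i v => G i v) s : ℕ) := by
  obtain ⟨L, hL, hLN⟩ := exists_sequence_coding
  have hL' : ∀ {α : Type} [Primcodable α] {f g : α → ℕ}, Computable f → Computable g →
      Computable fun a => L (f a) (g a) := fun hf hg => hL.comp (hf.pair hg)
  have hstep : DeltaPred (m + 1) fun z : (ℕ × ℕ) × ℕ =>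
      ∀ i, i + 1 ≤ z.1.1 → G i (L z.2 i) = L z.2 (i + 1) :=
    .forall_nat (r := fun (z : (ℕ × ℕ) × ℕ) i => i + 1 ≤ z.1.1 → G i (L z.2 i) = L z.2 (i + 1))
      ((DeltaPred.nat_le (by fun_prop) (by fun_prop)).imp
        (DeltaPred.comp hG (f := fun z : ((ℕ × ℕ) × ℕ) × ℕ =>
          ((z.2, L z.1.2 z.2), L z.1.2 (z.2 + 1)))
          (((Computable.snd).pair (hL' (by fun_prop) (by fun_prop))).pair
            (hL' (by fun_prop) (by fun_prop)))))
  have h0 : DeltaPred (m + 1) fun z : (ℕ × ℕ) × ℕ => L z.2 0 = c :=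
    .nat_eq (hL' (by fun_prop) (by fun_prop)) (by fun_prop)
  have h1 : DeltaPred (m + 1) fun z : (ℕ × ℕ) × ℕ => L z.2 z.1.1 = z.1.2 :=
    .nat_eq (hL' (by fun_prop) (by fun_prop)) (by fun_prop)
  refine (DeltaPred.exists_nat (r := fun (z : ℕ × ℕ) l => L l 0 = c ∧
    (∀ i, i + 1 ≤ z.1 → G i (L l i) = L l (i + 1)) ∧ L l z.1 = z.2)
    (h0.and (hstep.and h1))).of_eq fun ⟨s, y⟩ => ?_
  let N : ℕ → ℕ := fun s => Nat.rec c (fun i v => G i v) s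
  change (∃ l, L l 0 = c ∧ (∀ i, i + 1 ≤ s → G i (L l i) = L l (i + 1)) ∧ L l s = y) ↔ N s = y
  constructor
  · rintro ⟨l, h0, hs, h1⟩
    have : ∀ i, i ≤ s → L l i = N i := by
      intro i
      induction i with
      | zero => exact fun _ => h0
      | succ i ih =>
        intro hi
        rw [← hs i hi, ih (by omega)]
    rw [← this s le_rfl, h1]
  · rintro rfl
    obtain ⟨l, hl⟩ := hLN N s
    refine ⟨l, hl 0 (Nat.zero_le _), fun i hi => ?_, hl s le_rfl⟩
    rw [hl i (by omega), hl _ hi]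

theorem of_graph {f : ℕ → ℕ} (hf : {z : ℕ | ∃ k : ℕ, z = Nat.pair k (f k)} ∈ DeltaOne n) :
    DeltaFun n f := by
  refine ⟨_, hf, fun ⟨a, b⟩ => ?_⟩
  simp only [encode_prod_val, encode_nat, Set.mem_ofPred_eq, Nat.pair_eq_pair]
  exact ⟨fun h => ⟨a, rfl, h.symm⟩, fun ⟨k, h, h'⟩ => h ▸ h'.symm⟩

end DeltaFun

-- Reindexing a numbering along a `Δ¹ₙ` function.

section Preimage

variable {m : ℕ} {X : Set ℕ}

theorem sigmaOne_preimage_deltaFun (hX : X ∈ SigmaOne (m + 1)) {h : ℕ → ℕ}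
    (hh : DeltaFun (m + 1) h) : h ⁻¹' X ∈ SigmaOne (m + 1) := by
  obtain ⟨Y, hY, hYh⟩ := hh
  convert! sigmaOne_exists (sigmaOne_inter (mem_deltaOne_iff.1 hY).1
    (sigmaOne_preimage hX computable_snd)) using 1
  ext x
  have : ∀ y, Nat.pair x y ∈ Y ↔ h x = y := fun y => by simpa using (hYh (x, y)).symm
  simp [this]

theorem eOne_preimage_deltaFun (hX : X ∈ EOne (m + 1)) {h : ℕ → ℕ}
    (hh : DeltaFun (m + 1) h) : h ⁻¹' X ∈ EOne (m + 1) := by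
  unfold EOne at *
  split_ifs at * with hm
  · rw [← compl_mem_sigmaOne_iff] at *
    exact sigmaOne_preimage_deltaFun hX hh
  · exact sigmaOne_preimage_deltaFun hX hh

/-- The numbering `k ↦ ν (g k)`. -/
def ComputableNumbering.reindex {T : Set (Set ℕ)} (ν : ComputableNumbering (EOne (m + 1)) T)
    (g : ℕ → ℕ) (hg : DeltaFun (m + 1) g) (hT : ∀ k, ∃ j, ν (g j) = ν k) :
    ComputableNumbering (EOne (m + 1)) T where
  toFun k := ν (g k)
  range_eq := by
    refine Eq.trans ?_ ν.range_eq
    ext A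
    constructor
    · rintro ⟨k, rfl⟩
      exact ⟨g k, rfl⟩
    · rintro ⟨k, rfl⟩
      exact hT k
  mem_class := by
    convert! eOne_preimage_deltaFun ν.mem_class
      ((hg.comp_computable computable_fst).pair (.of_computable computable_snd))
      using 1
    ext z
    simp only [Set.mem_ofPred_eq, Set.mem_preimage, Nat.pair_eq_pair]
    constructor
    · rintro ⟨k, x, rfl, hx⟩
      exact ⟨_, _, ⟨rfl, rfl⟩, by simpa using hx⟩
    · rintro ⟨k, x, ⟨rfl, rfl⟩, hx⟩
      exact ⟨_, _, (Nat.pair_unpair z).symm, hx⟩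

end Preimage

end

-- Construction of the minimal function.

section

open Nat.Partrec (Code)

/-- A computable surjection can be coarsened, keeping its values up to `s`, so that a given
computable sequence either meets only boundedly many classes, or every class above `s`. -/
theorem exists_coarsening {p h : ℕ → ℕ} (hp : Computable p) (hps : Function.Surjective p)
    (hh : Computable h) (s : ℕ) : ∃ p' : ℕ → ℕ, Computable p' ∧ Function.Surjective p' ∧
      (∀ x, p' x ≤ p x) ∧ (∀ x, p x ≤ s → p' x = p x) ∧ (∀ x x', p x = p x' → p' x = p' x') ∧
      ((∃ b, ∀ t, p' (h t) ≤ b) ∨ ∀ j, s + 1 ≤ j → ∃ t, p' (h t) = j) := by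
  by_cases hb : ∃ b, ∀ t, p (h t) ≤ b
  · exact ⟨p, hp, hps, fun _ => le_rfl, fun _ _ => rfl, fun _ _ => id, .inl hb⟩
  have hex : ∀ b, ∃ t, b < p (h t) := by
    intro b
    by_contra hcon
    exact hb ⟨b, fun t => not_lt.1 fun ht => hcon ⟨t, ht⟩⟩
  let next : ℕ → ℕ := fun b => p (h (Nat.find (hex b)))
  have hnext : ∀ b, b < next b := fun b => Nat.find_spec (hex b)
  have hlt : ComputablePred fun z : ℕ × ℕ => z.1 < z.2 :=
    (Primrec.nat_lt.comp .fst .snd).computablePred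
  have hle : ComputablePred fun z : ℕ × ℕ => z.1 ≤ z.2 :=
    (Primrec.nat_le.comp .fst .snd).computablePred
  have hnextc : Computable next := hp.comp (hh.comp (Computable.find (P := fun b t => b < p (h t))
    (Computable.computablePred (hlt.decide.comp (g := fun z : ℕ × ℕ => (z.1, p (h z.2)))
      (by fun_prop))) hex))
  -- A computable increasing sequence of values of `p ∘ h`, all above `s`.
  let w : ℕ → ℕ := fun i => Nat.rec (motive := fun _ => ℕ) (next s) (fun _ v => next v) i
  have hwc : Computable w := Computable.nat_rec .id (.const _)
    (hnextc.comp (Computable.snd.comp .snd)).to₂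
  have hw : StrictMono w := strictMono_nat_of_lt_succ fun i => hnext _
  have hws : ∀ i, s + 1 + i ≤ w i := by
    intro i
    induction i with
    | zero => exact hnext s
    | succ i ih => exact lt_of_le_of_lt ih (hnext (w i))
  have hwp : ∀ i, ∃ t, p (h t) = w i := fun i => by
    cases i with
    | zero => exact ⟨_, rfl⟩
    | succ i => exact ⟨_, rfl⟩
  have hwex : ∀ j : ℕ, ∃ i : ℕ, j ≤ w i := fun j => ⟨j, (Nat.le_add_left _ _).trans (hws j)⟩
  let idx : ℕ → ℕ := fun j => Nat.find (hwex j)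
  have hidxc : Computable idx := Computable.find (P := fun j i => j ≤ w i)
    (Computable.computablePred (hle.decide.comp (g := fun z : ℕ × ℕ => (z.1, w z.2))
      (by fun_prop))) hwex
  have hidx : ∀ i, idx (w i) = i := fun i =>
    (Nat.find_eq_iff _).2 ⟨le_rfl, fun k hk => not_le.2 (hw hk)⟩
  -- Values up to `s` are kept, `w i` is renumbered as `s + 1 + i`, and all other values are merged
  -- into the class of `0`. Thus `p ∘ h` followed by `r` meets every class above `s`, and no value
  -- increases.
  let r : ℕ → ℕ := fun j => if j ≤ s then j else if w (idx j) = j then s + 1 + idx j else 0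
  have hrc : Computable r := by
    have h₁ : ComputablePred fun j => w (idx j) = j :=
      Computable.computablePred (((Primrec.eq (α := ℕ)).computablePred.decide).comp
        (g := fun j => (w (idx j), j)) (by fun_prop))
    have h₂ : ComputablePred fun j => j ≤ s :=
      (Primrec.nat_le.comp .id (.const s)).computablePred
    exact ComputablePred.ite .id (ComputablePred.ite
      (computable_add.comp (f := fun z : ℕ × ℕ => z.1 + z.2) (g := fun j => (s + 1, idx j))
        (by fun_prop)) (.const 0) h₁) h₂
  have hr₁ : ∀ j, j ≤ s → r j = j := fun j hj => if_pos hj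
  have hr₂ : ∀ i, r (w i) = s + 1 + i := fun i => by
    have := hws i
    simp only [r, hidx]
    rw [if_neg (by omega), if_pos trivial]
  have hr₃ : ∀ j, r j ≤ j := fun j => by
    simp only [r]
    split_ifs with h₁ h₂
    · exact le_rfl
    · exact (hws _).trans h₂.le
    · exact Nat.zero_le _
  have hmeet : ∀ j, s + 1 ≤ j → ∃ t, r (p (h t)) = j := by
    intro j hj
    obtain ⟨i, rfl⟩ := Nat.exists_eq_add_of_le hj
    obtain ⟨t, ht⟩ := hwp i
    exact ⟨t, by rw [ht, hr₂]⟩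
  refine ⟨fun x => r (p x), hrc.comp hp, fun y => ?_, fun x => hr₃ _, fun x hx => hr₁ _ hx,
    fun x x' hx => congrArg r hx, .inr hmeet⟩
  by_cases hy : y ≤ s
  · obtain ⟨x, rfl⟩ := hps y
    exact ⟨x, hr₁ _ hy⟩
  · obtain ⟨t, ht⟩ := hmeet y (by omega)
    exact ⟨h t, ht⟩

/-- The program with number `c` outputs `y` on input `x`. -/
def InGraph (c x y : ℕ) : Prop := y ∈ (Denumerable.ofNat Code c).eval x

theorem InGraph.unique {c x y y' : ℕ} (h : InGraph c x y) (h' : InGraph c x y') : y = y' :=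
  Part.mem_unique h h'

theorem exists_inGraph_iff {p : ℕ → ℕ} (hp : Computable p) :
    ∃ c, ∀ x y, InGraph c x y ↔ p x = y := by
  obtain ⟨c, hc⟩ := Code.exists_code.1 (Partrec.nat_iff.1 hp.partrec)
  refine ⟨Encodable.encode c, fun x y => ?_⟩
  rw [InGraph, Denumerable.ofNat_encode, hc]
  exact Part.mem_some_iff.trans eq_comm

theorem exists_computable_of_inGraph {c : ℕ} (hc : ∀ x, ∃ y, InGraph c x y) :
    ∃ p : ℕ → ℕ, Computable p ∧ ∀ x y, InGraph c x y ↔ p x = y := by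
  choose p hp using hc
  exact ⟨p, Partrec.of_eq_tot (Partrec.nat_iff.2 (Code.exists_code.2 ⟨_, rfl⟩)) hp,
    fun x y => ⟨fun h => (hp x).unique h, fun h => h ▸ hp x⟩⟩

/-- The programs `c` and `c'` compute a surjection and a coarsening of it as in
`exists_coarsening`, for the sequence computed by the program `s`. -/
def Refines (s c c' : ℕ) : Prop :=
  (∀ x, ∃ y, InGraph c' x y) ∧ (∀ y, ∃ x, InGraph c' x y) ∧
  (∀ x y y', InGraph c x y → InGraph c' x y' → y' ≤ y ∧ (y ≤ s → y' = y)) ∧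
  (∀ x x' y y', InGraph c x y → InGraph c x' y → InGraph c' x y' → InGraph c' x' y') ∧
  ((∀ t, ∃ a, InGraph s t a) →
    (∃ b, ∀ t a y, InGraph s t a → InGraph c' a y → y ≤ b) ∨
      ∀ j, s + 1 ≤ j → ∃ t a, InGraph s t a ∧ InGraph c' a j)

theorem DeltaPred.inGraph {m : ℕ} {α : Type*} [Primcodable α] {e a b : α → ℕ} (he : Computable e)
    (ha : Computable a) (hb : Computable b) :
    DeltaPred (m + 1) fun x => InGraph (e x) (a x) (b x) :=
  DeltaPred.mem_eval he ha hb

/-- Every quantifier ranges over numbers and the matrix concerns halting computations. Speaking of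
graphs makes the condition meaningful for partial programs too, so that it is `Δ¹ₙ` in all indices.
-/
theorem deltaPred_refines (m : ℕ) :
    DeltaPred (m + 1) fun z : (ℕ × ℕ) × ℕ => Refines z.1.1 z.1.2 z.2 := by
  unfold Refines
  repeat' first
    | refine DeltaPred.inGraph ?_ ?_ ?_
    | refine DeltaPred.nat_le ?_ ?_
    | refine DeltaPred.nat_eq ?_ ?_
    | refine DeltaPred.and ?_ ?_
    | refine DeltaPred.or ?_ ?_
    | refine DeltaPred.exists_nat ?_
    | refine DeltaPred.imp ?_ ?_
    | refine DeltaPred.forall_nat ?_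
  all_goals fun_prop

theorem exists_refines {s c : ℕ} {p : ℕ → ℕ} (hp : Computable p) (hps : Function.Surjective p)
    (hc : ∀ x y, InGraph c x y ↔ p x = y) : ∃ c', Refines s c c' := by
  obtain ⟨h, hh, hhs⟩ : ∃ h : ℕ → ℕ, Computable h ∧
      ((∀ t, ∃ a, InGraph s t a) → ∀ t a, InGraph s t a ↔ h t = a) := by
    by_cases ht : ∀ t, ∃ a, InGraph s t a
    · obtain ⟨h, hh, hhs⟩ := exists_computable_of_inGraph ht
      exact ⟨h, hh, fun _ => hhs⟩
    -- If program `s` is not total, the dichotomy is required of nothing and any sequence will do.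
    · exact ⟨id, .id, fun h => absurd h ht⟩
  obtain ⟨p', hp', hs, hle, heq, hcoh, hd⟩ := exists_coarsening hp hps hh s
  obtain ⟨c', hc'⟩ := exists_inGraph_iff hp'
  refine ⟨c', ?_⟩
  simp only [Refines, hc, hc']
  refine ⟨fun x => ⟨_, rfl⟩, hs, ?_, ?_, fun ht => ?_⟩
  · rintro x _ _ rfl rfl
    exact ⟨hle x, heq x⟩
  · rintro x x' _ _ rfl hx rfl
    exact hcoh _ _ hx
  · simp only [hhs ht]
    refine hd.imp ?_ fun H j hj => ?_
    · rintro ⟨b, hb⟩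
      refine ⟨b, ?_⟩
      rintro t _ _ rfl rfl
      exact hb t
    · obtain ⟨t, ht'⟩ := H j hj
      exact ⟨t, _, rfl, ht'⟩

/-- The sequence of successively coarser surjections. -/
theorem exists_tower (m : ℕ) : ∃ (C : ℕ → ℕ) (P : ℕ → ℕ → ℕ), DeltaFun (m + 1) C ∧
    (∀ s x y, InGraph (C s) x y ↔ P s x = y) ∧ (∀ x, P 0 x = x) ∧
    (∀ s, Computable (P s)) ∧ (∀ s, Function.Surjective (P s)) ∧
    (∀ s x, P (s + 1) x ≤ P s x) ∧ (∀ s x, P s x ≤ s → P (s + 1) x = P s x) ∧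
    (∀ s x x', P s x = P s x' → P (s + 1) x = P (s + 1) x') ∧
    (∀ s (h : ℕ → ℕ), (∀ t a, InGraph s t a ↔ h t = a) →
      (∃ b, ∀ t, P (s + 1) (h t) ≤ b) ∨ ∀ j, s + 1 ≤ j → ∃ t, P (s + 1) (h t) = j) := by
  obtain ⟨c, hc⟩ := exists_inGraph_iff Computable.id
  -- Taking the least refining program makes the tower definable by primitive recursion from a `Δ¹ₙ`
  -- step.
  let C : ℕ → ℕ := fun s => Nat.rec c (fun i v => sInf {c' | Refines i v c'}) s
  have hC : DeltaFun (m + 1) C := DeltaFun.nat_rec (DeltaFun.sInf (deltaPred_refines m)) c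
  have hinv : ∀ s, ∃ p : ℕ → ℕ, Computable p ∧ Function.Surjective p ∧
      ∀ x y, InGraph (C s) x y ↔ p x = y := by
    intro s
    induction s with
    | zero => exact ⟨id, .id, Function.surjective_id, hc⟩
    | succ s ih =>
      obtain ⟨p, hp, hps, hpC⟩ := ih
      have hR : Refines s (C s) (C (s + 1)) := Nat.sInf_mem (exists_refines hp hps hpC)
      obtain ⟨p', hp', hpC'⟩ := exists_computable_of_inGraph hR.1
      exact ⟨p', hp', fun y => (hR.2.1 y).imp fun x hx => (hpC' x y).1 hx, hpC'⟩
  choose P hP hPs hPC using hinv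
  have hR : ∀ s, Refines s (C s) (C (s + 1)) := fun s =>
    Nat.sInf_mem (exists_refines (hP s) (hPs s) (hPC s))
  have hval : ∀ s x, InGraph (C s) x (P s x) := fun s x => (hPC s x _).2 rfl
  refine ⟨C, P, hC, hPC, fun x => (hPC 0 x x).1 ((hc x x).2 rfl), hP, hPs, ?_, ?_, ?_, ?_⟩
  · intro s x
    obtain ⟨-, -, h, -⟩ := hR s
    exact (h x _ _ (hval s x) (hval (s + 1) x)).1
  · intro s x
    obtain ⟨-, -, h, -⟩ := hR s
    exact (h x _ _ (hval s x) (hval (s + 1) x)).2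
  · intro s x x' hx
    obtain ⟨-, -, -, h, -⟩ := hR s
    exact ((hPC _ _ _).1 (h x x' _ _ (hval _ _) ((hPC _ _ _).2 hx.symm)
      (hval (s + 1) x))).symm
  · intro s h hh
    obtain ⟨-, -, -, -, hd⟩ := hR s
    simp only [hh, hPC] at hd
    refine (hd fun t => ⟨_, rfl⟩).imp ?_ fun H j hj => ?_
    · exact fun ⟨b, hb⟩ => ⟨b, fun t => hb t _ _ rfl rfl⟩
    · obtain ⟨t, a, rfl, ha⟩ := H j hj
      exact ⟨t, ha⟩

/-- There is a `Δ¹ₙ` function that agrees somewhere with each computable function, and is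
minimal: it factors through computable functions that, on the range of a given computable sequence,
are either bounded, or take there all but boundedly many of their values. -/
theorem exists_minimal_function (m : ℕ) : ∃ u : ℕ → ℕ, DeltaFun (m + 1) u ∧
    (∀ h : ℕ → ℕ, Computable h → ∃ k, u k = h k) ∧
    ∀ h : ℕ → ℕ, Computable h → ∃ (p : ℕ → ℕ) (s : ℕ), Computable p ∧ p 0 = 0 ∧
      (∀ a a', p a = p a' → u a = u a') ∧
      ((∃ b, ∀ t, p (h t) ≤ b) ∨ ∀ j, s + 1 ≤ j → ∃ t, p (h t) = j) := by
  obtain ⟨C, P, hC, hPC, hP0, hP, hPs, hle, heq, hcoh, hd⟩ := exists_tower m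
  have hstable : ∀ {s t x}, P s x ≤ s → s ≤ t → P t x = P s x := by
    intro s t x hs hst
    induction t, hst using Nat.le_induction with
    | base => rfl
    | succ t hst ih => rw [heq t x (by omega), ih]
  have hself : ∀ s x, P s x ≤ x := by
    intro s x
    induction s with
    | zero => exact (hP0 x).le
    | succ s ih => exact (hle s x).trans ih
  have hcoh' : ∀ {s t x x'}, P s x = P s x' → s ≤ t → P t x = P t x' := by
    intro s t x x' h hst
    induction t, hst using Nat.le_induction with
    | base => exact h
    | succ t hst ih => exact hcoh t _ _ ih
  -- Since `P k k ≤ k`, the value at `k` no longer changes after stage `k`.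
  let lim : ℕ → ℕ := fun k => P k k
  have hlim : DeltaFun (m + 1) lim := by
    have h : DeltaPred (m + 1) fun z : ℕ × ℕ => InGraph (C z.1) z.1 z.2 :=
      DeltaPred.subst (r := fun (z : ℕ × ℕ) c => InGraph c z.1 z.2)
        (.inGraph (by fun_prop) (by fun_prop) (by fun_prop)) (hC.comp_computable .fst)
    exact h.of_eq fun z => hPC _ _ _
  -- The value `j` is frozen from stage `j` on, so a point of the fibre of `P j` over `j` lies in
  -- the fibre of `lim` over `j`.
  let wit : ℕ → ℕ := fun j => sInf {k | InGraph (C j) k j}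
  have hwit : DeltaFun (m + 1) wit := by
    refine DeltaFun.sInf (r := fun j k => InGraph (C j) k j) ?_
    exact DeltaPred.subst (r := fun (z : ℕ × ℕ) c => InGraph c z.2 z.1)
      (.inGraph (by fun_prop) (by fun_prop) (by fun_prop)) (hC.comp_computable .fst)
  have hwit' : ∀ j, P j (wit j) = j := fun j =>
    (hPC _ _ _).1 (Nat.sInf_mem (s := {k | InGraph (C j) k j})
      ((hPs j j).imp fun k hk => (hPC _ _ _).2 hk))
  have hlim_wit : ∀ j, lim (wit j) = j := by
    intro j
    rcases le_total j (wit j) with h | h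
    · exact (hstable (hwit' j).le h).trans (hwit' j)
    · exact (hstable (hself _ _) h).symm.trans (hwit' j)
  let v : ℕ → ℕ := fun j => sInf {y | InGraph j (wit j) y}
  have hv : DeltaFun (m + 1) v := by
    refine DeltaFun.sInf (r := fun j y => InGraph j (wit j) y) ?_
    exact DeltaPred.subst (r := fun (z : ℕ × ℕ) k => InGraph z.1 k z.2)
      (.inGraph (by fun_prop) (by fun_prop) (by fun_prop)) (hwit.comp_computable .fst)
  refine ⟨fun k => v (lim k), hv.comp hlim, fun h hh => ?_, fun h hh => ?_⟩
  · obtain ⟨j, hj⟩ := exists_inGraph_iff hh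
    refine ⟨wit j, ?_⟩
    have : {y | InGraph j (wit j) y} = {h (wit j)} := by
      ext y
      simp [hj, eq_comm]
    simp only [hlim_wit, v, this, csInf_singleton]
  · obtain ⟨s, hs⟩ := exists_inGraph_iff hh
    -- Points identified at stage `s + 1` remain identified later, hence by `lim`; so `u` factors
    -- through `P (s + 1)`.
    refine ⟨P (s + 1), s, hP _, Nat.le_zero.1 (hself _ _), fun a a' ha => ?_, hd s h hs⟩
    have hlim' : ∀ {x t}, x ≤ t → P t x = lim x := fun h => hstable (hself _ _) h
    have : lim a = lim a' := by
      rw [← hlim' (t := max (s + 1) (max a a')) (by omega),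
        ← hlim' (x := a') (t := max (s + 1) (max a a')) (by omega)]
      exact hcoh' ha (by omega)
    simp only [this]

end

-- From the minimal function to the minimal cover.

theorem computable_halve : Computable fun k : ℕ => k / 2 :=
  (Primrec.nat_div.comp .id (.const 2)).to_comp

theorem computablePred_even : ComputablePred fun k : ℕ => k % 2 = 0 :=
  (Primrec.eq.comp (Primrec.nat_mod.comp .id (.const 2)) (.const 0)).computablePred

theorem computable_finite_support (δ : ℕ → ℕ) (b : ℕ) :
    ∃ e : ℕ → ℕ, Computable e ∧ ∀ j, j ≤ b → e j = δ j := by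
  refine ⟨fun j => ((List.range (b + 1)).map δ).getD j 0,
    ((Primrec.list_getD 0).comp (.const _) .id).to_comp, fun j hj => ?_⟩
  simp [List.getD_eq_getElem?_getD, List.getElem?_range (Nat.lt_succ_of_le hj)]

/-- The numbering `ν ⊕ (ν ∘ f ∘ u)` for a minimal function `u` bounds only the degrees of `ν` and
of itself above `ν`. -/
theorem reducible_or_reducible_of_between {ν μ κ : ℕ → Set ℕ} {u g : ℕ → ℕ}
    (hu : ∀ h : ℕ → ℕ, Computable h → ∃ (p : ℕ → ℕ) (s : ℕ), Computable p ∧ p 0 = 0 ∧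
      (∀ a a', p a = p a' → u a = u a') ∧
      ((∃ b, ∀ t, p (h t) ≤ b) ∨ ∀ j, s + 1 ≤ j → ∃ t, p (h t) = j))
    (hμ₀ : ∀ k, μ (2 * k) = ν k) (hμ₁ : ∀ k, μ (2 * k + 1) = ν (g (u k)))
    (hνκ : Reducible ν κ) (hκμ : Reducible κ μ) : Reducible κ ν ∨ Reducible μ κ := by
  obtain ⟨r, hr, hνκ⟩ := hνκ
  obtain ⟨h, hh, hκμ⟩ := hκμ
  have hhe : ComputablePred fun t => h t % 2 = 0 :=
    Computable.computablePred (computablePred_even.decide.comp hh)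
  have hh2 : Computable fun t => h t / 2 := computable_halve.comp hh
  -- Indices landing in the half of `ν` are sent to `0`, whose class under `p` is `0` and so never
  -- exceeds `s`.
  let h' : ℕ → ℕ := fun t => if h t % 2 = 0 then 0 else h t / 2
  have hh' : Computable h' := ComputablePred.ite (.const 0) hh2 hhe
  obtain ⟨p, s, hp, hp0, hpu, hd⟩ := hu h' hh'
  have hκ₀ : ∀ t, h t % 2 = 0 → κ t = ν (h t / 2) := fun t ht => by
    rw [hκμ, ← hμ₀, show 2 * (h t / 2) = h t by omega]
  have hκ₁ : ∀ t, h t % 2 ≠ 0 → κ t = ν (g (u (h' t))) := fun t ht => by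
    rw [hκμ, ← hμ₁, show 2 * h' t + 1 = h t by simp only [h', if_neg ht]; omega]
  -- The function through which `g ∘ u` factors over `p`. It need not be computable; only finite
  -- parts of it are used.
  let δ : ℕ → ℕ := fun j => g (u (sInf {a | p a = j}))
  have hδ : ∀ a, δ (p a) = g (u a) := fun a =>
    congrArg g (hpu _ _ (Nat.sInf_mem (s := {a' | p a' = p a}) ⟨a, rfl⟩))
  rcases hd with ⟨b, hb⟩ | hd
  · left
    obtain ⟨e, he, heδ⟩ := computable_finite_support δ b
    refine ⟨fun t => if h t % 2 = 0 then h t / 2 else e (p (h' t)),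
      ComputablePred.ite hh2 (he.comp (hp.comp hh')) hhe, fun t => ?_⟩
    by_cases ht : h t % 2 = 0
    · simp only [if_pos ht, hκ₀ t ht]
    · simp only [if_neg ht, hκ₁ t ht, heδ _ (hb t), hδ]
  · right
    obtain ⟨e, he, heδ⟩ := computable_finite_support δ s
    -- The first alternative makes the search total; its result is used only when `p a > s`.
    have hex : ∀ a, ∃ t, p a ≤ s ∨ p (h' t) = p a := fun a => by
      by_cases ha : p a ≤ s
      · exact ⟨0, .inl ha⟩
      · exact (hd (p a) (by omega)).imp fun t ht => .inr ht
    have hP : ComputablePred fun z : ℕ × ℕ => p z.1 ≤ s ∨ p (h' z.2) = p z.1 := by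
      have : ComputablePred fun z : ℕ × ℕ => z.1 ≤ s ∨ z.2 = z.1 :=
        ((Primrec.nat_le.comp .fst (.const s)).or (Primrec.eq.comp .snd .fst)).computablePred
      exact Computable.computablePred (this.decide.comp
        (g := fun z : ℕ × ℕ => (p z.1, p (h' z.2))) (by fun_prop))
    let find : ℕ → ℕ := fun a => Nat.find (hex a)
    have hfind : Computable find :=
      Computable.find (P := fun a t => p a ≤ s ∨ p (h' t) = p a) hP hex
    have hsmall : ComputablePred fun k => p (k / 2) ≤ s :=
      Computable.computablePred ((Primrec.nat_le.comp .id (.const s)).computablePred.decide.comp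
        (hp.comp computable_halve))
    refine ⟨fun k => if k % 2 = 0 then r (k / 2) else
        if p (k / 2) ≤ s then r (e (p (k / 2))) else find (k / 2),
      ComputablePred.ite (hr.comp computable_halve) (ComputablePred.ite
        (hr.comp (he.comp (hp.comp computable_halve))) (hfind.comp computable_halve) hsmall)
        computablePred_even, fun k => ?_⟩
    by_cases hk : k % 2 = 0
    · obtain ⟨a, rfl⟩ : ∃ a, k = 2 * a := ⟨k / 2, by omega⟩
      simp only [if_pos hk, ← hνκ, hμ₀, Nat.mul_div_cancel_left a two_pos]
    · obtain ⟨a, rfl⟩ : ∃ a, k = 2 * a + 1 := ⟨k / 2, by omega⟩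
      simp only [if_neg hk, hμ₁, show (2 * a + 1) / 2 = a by omega]
      by_cases ha : p a ≤ s
      · simp only [if_pos ha, ← hνκ, heδ _ ha, hδ]
      · have hspec : p (h' (find a)) = p a := (Nat.find_spec (hex a)).resolve_left ha
        -- An even `h (find a)` would give `p a = p 0 = 0 ≤ s`.
        have hodd : h (find a) % 2 ≠ 0 := fun h0 => by
          simp only [h', if_pos h0, hp0] at hspec
          omega
        simp only [if_neg ha]
        rw [hκ₁ _ hodd, hpu _ _ hspec]

end AnalyticalRogers

theorem mainTheorem10 (n : ℕ) (hn : 1 ≤ n) (T : Set (Set ℕ))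
    (ν : AnalyticalRogers.ComputableNumbering (AnalyticalRogers.EOne n) T)
    (f : ℕ → ℕ)
    (hf : {z : ℕ | ∃ k : ℕ, z = Nat.pair k (f k)} ∈ AnalyticalRogers.DeltaOne n)
    (hne : ∀ k : ℕ, ν k ≠ ν (f k)) :
    ∃ b : AnalyticalRogers.RogersSemilattice (AnalyticalRogers.EOne n) T,
      AnalyticalRogers.IsMinimalCover b (AnalyticalRogers.degree ν) := by
  open AnalyticalRogers in
  obtain ⟨m, rfl⟩ : ∃ m, n = m + 1 := ⟨n - 1, by omega⟩
  obtain ⟨u, hu, hdiag, hmin⟩ := exists_minimal_function m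
  have hg : DeltaFun (m + 1) fun k => if k % 2 = 0 then k / 2 else f (u (k / 2)) :=
    (DeltaFun.of_computable computable_halve).ite
      ((DeltaFun.of_graph hf).comp (hu.comp_computable computable_halve))
      (.of_computablePred computablePred_even)
  let μ := ν.reindex _ hg fun k => ⟨2 * k, by
    simp only [Nat.mul_mod_right, if_true, Nat.mul_div_cancel_left k two_pos]⟩
  have hμ₀ : ∀ k, μ (2 * k) = ν k := fun k => by
    change ν _ = _
    simp only [Nat.mul_mod_right, if_true, Nat.mul_div_cancel_left k two_pos]
  have hμ₁ : ∀ k, μ (2 * k + 1) = ν (f (u k)) := fun k => by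
    change ν _ = _
    simp only [show (2 * k + 1) % 2 = 1 by omega, one_ne_zero, if_false,
      show (2 * k + 1) / 2 = k by omega]
  refine ⟨degree μ, ?_, ?_⟩
  · refine toAntisymmetrization_lt_toAntisymmetrization_iff.2 (lt_iff_le_not_ge.2 ⟨?_, ?_⟩)
    · exact ⟨fun k => 2 * k, (Primrec.nat_mul.comp (.const 2) .id).to_comp,
        fun k => (hμ₀ k).symm⟩
    · rintro ⟨h, hh, hμν⟩
      -- At the point of agreement the supposed reduction yields `ν (u k) = ν (f (u k))`.
      obtain ⟨k, hk⟩ := hdiag (fun k => h (2 * k + 1))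
        (hh.comp (Primrec.nat_double_succ).to_comp)
      exact hne _ (((hμν (2 * k + 1)).symm.trans (hμ₁ k)).trans (by rw [hk]))
  · rintro ⟨c, hνc, hcμ⟩
    induction c using Antisymmetrization.ind with
    | _ κ =>
      have h₁ := toAntisymmetrization_lt_toAntisymmetrization_iff.1 hνc
      have h₂ := toAntisymmetrization_lt_toAntisymmetrization_iff.1 hcμ
      rcases reducible_or_reducible_of_between hmin hμ₀ hμ₁ h₁.le h₂.le with h | h
      · exact h₁.not_ge h
      · exact h₂.not_ge h
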